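/- Let $\mathcal{A}=\langle A_\alpha:\alpha\le\omega_1\rangle$ be a sequence of subsets of $2^\omega$ such that $A_\alpha$ is countable and dense for each $\alpha<\omega_1$, $A_\alpha\subseteq A_\beta$ whenever $\alpha<\beta$, $A_{\omega_1}=\bigcup_{\alpha<\omega_1}A_\alpha$, and $\{\alpha<\omega_1: A_\alpha=\bigcup_{\beta<\alpha}A_\beta\}$ is stationary in $\omega_1$. **The quantifier.** Let $\mathcal{T}=(M,R_0,R_1,R_2,R_3,R_4)$ be a structure with $R_0,R_1,R_2$ binary and $R_3,R_4$ unary. For $a\in M$ and $\eta\in 2^n$ say that $a$ *represents* $\eta$ if $R_4(a)$ and there are $y_0,\dots,y_n\in M$ with $R_3(y_0)$, $R_4(y_i)$ and $R_2(y_i,a)$ for all $i\le n$, and $R_{\eta(i)}(y_i,y_{i+1})$ for all $i<n$. Let $\Omega(\mathcal{T})$ be the set of $\eta\in2^\omega$ such that some $a\in M$ represents $\eta\restriction n$ for every $n<\omega$. Let $\mathcal{K}_{\mathcal{A}}$ be the class of those $\mathcal{T}$ that satisfy the following three conditions. 1. *Tree-likeness* ($\Theta_{\mathrm{TL}}$):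 some $x$ with $R_3(x)$ satisfies $R_2(x,y)$ for all $y$ with $R_4(y)$; $R_0\cup R_1\subseteq R_2\subseteq R_4\times R_4$; $R_2$ is reflexive on $R_4$ and transitive; and if $R_2(y,x)$ and $R_2(z,x)$, then $R_2(y,z)$ or $R_2(z,y)$. 2. *Unique representation*: for every $n$, each $a\in M$ represents at most one $\eta\in2^n$. 3. $\Omega(\mathcal{T})\cap A_{\omega_1}=A_\alpha$ for some $\alpha\le\omega_1$. The quantifier $Q_{\mathcal{A}}$ is the Lindström quantifier of this class: a structure $\mathcal{M}$ with parameters $\bar c$ satisfies $$(Q_{\mathcal{A}}x_0x_1)(\psi_0(x_0,x_1,\bar c),\psi_1(x_0,x_1,\bar c),\psi_2(x_0,x_1,\bar c),\psi_3(x_0,\bar c),\psi_4(x_0,\bar c))$$ if and only if the structure on $M$ whose relations $R_0,\dots,R_4$ are defined in $\mathcal{M}$ by these five formulas belongs to $\mathcal{K}_{\mathcal{A}}$. **The logics.** Let $L^{d0}_{\mathcal{A}}$ be the closure of first order logic under $\wedge,\vee,\exists,\forall$ (first order quantifiers only) and $Q_{\mathcal{A}}$. Let $L^{d1}_{\mathcal{A}}$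 be its extension obtained by adding negation to the logical operations. For $L\in\{L^{d0}_{\mathcal{A}},L^{d1}_{\mathcal{A}}\}$ write $\mathcal{N}\preccurlyeq_{L}\mathcal{M}$ if $\mathcal{N}$ is a substructure of $\mathcal{M}$ and $\mathcal{N}\models\phi(\bar a)\iff\mathcal{M}\models\phi(\bar a)$ for all $L$-formulas $\phi$ and all tuples $\bar a$ from $N$. **Theorem (Downward Löwenheim–Skolem–Tarski).** Let $\mathcal{M}$ be a structure for a countable vocabulary and let $X\subseteq M$ be countable. Then there is $\mathcal{N}\preccurlyeq_{L^{d1}_{\mathcal{A}}}\mathcal{M}$ such that $X\subseteq N$ and $|N|\le\aleph_0$. In particular, $\mathcal{N}\preccurlyeq_{L^{d0}_{\mathcal{A}}}\mathcal{M}$. -/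

import Mathlib

open scoped Ordinal

universe u v w

namespace DensityLogic

/-- The Cantor space `2^ω`, with its product topology. -/
abbrev Cantor : Type := ℕ → Bool

/-- The sequences `𝒜 = ⟨A_α : α ≤ ω₁⟩` of sets of reals from which the quantifier `Q_𝒜` is built:
an increasing sequence of countable dense sets with union `A_{ω₁}` that is continuous on a
stationary set of indices. (Only the values `A α` with `α ≤ ω₁` matter.) -/
structure IsDenseSequence (A : Ordinal.{0} → Set Cantor) : Prop where
  countable : ∀ α < ω₁, (A α).Countable
  dense : ∀ α < ω₁, Dense (A α)
  mono : ∀ α β, α < β → β ≤ ω₁ → A α ⊆ A β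
  top_eq : A ω₁ = ⋃ α < ω₁, A α
  stationary : IsStationary {α : Set.Iio (ω₁ : Ordinal.{0}) | A α = ⋃ β < (α : Ordinal.{0}), A β}

/-- A structure on `M` for the vocabulary `{R₀, R₁, R₂, R₃, R₄}`, with `R₀, R₁, R₂` binary and
`R₃, R₄` unary. -/
structure TreeModel (M : Type w) where
  R₀ : M → M → Prop
  R₁ : M → M → Prop
  R₂ : M → M → Prop
  R₃ : M → Prop
  R₄ : M → Prop

namespace TreeModel

variable {M : Type w} (T : TreeModel M)

/-- The relation `R_i`, for `i ∈ {0, 1}` (with `0 = false` and `1 = true`). -/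
def edge : Bool → M → M → Prop
  | false => T.R₀
  | true => T.R₁

/-- `T ⊨ ψ_η(x)` for a finite binary sequence `η` of length `n`, that is, `η ∈ Ω(T, x)`. -/
def Psi {n : ℕ} (η : Fin n → Bool) (x : M) : Prop :=
  T.R₄ x ∧ ∃ y : Fin (n + 1) → M, T.R₃ (y 0) ∧ (∀ i, T.R₄ (y i)) ∧
    (∀ i : Fin n, T.edge (η i) (y i.castSucc) (y i.succ)) ∧ ∀ i, T.R₂ (y i) x

/-- The set of reals `Ω(T)` represented by `T`. -/
def Omega : Set Cantor :=
  {η | ∃ a : M, ∀ n : ℕ, T.Psi (fun i : Fin n => η i) a}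

/-- The first order sentence `Θ_TL`: `R₂` is a tree-like partial order extending `R₀` and `R₁`. -/
def ThetaTL : Prop :=
  (∃ x, T.R₃ x ∧ ∀ y, T.R₄ y → T.R₂ x y) ∧
  (∀ x y, T.R₀ x y → T.R₂ x y) ∧
  (∀ x y, T.R₁ x y → T.R₂ x y) ∧
  (∀ x y, T.R₂ x y → T.R₄ x ∧ T.R₄ y) ∧
  (∀ x, T.R₄ x → T.R₂ x x) ∧
  (∀ x y z, T.R₂ x y → T.R₂ y z → T.R₂ x z) ∧
  (∀ x y z, T.R₂ y x → T.R₂ z x → T.R₂ y z ∨ T.R₂ z y)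

/-- Unique representation: an element represents at most one binary sequence of each length. -/
def UniqueRep : Prop :=
  ∀ (a : M) (n : ℕ) (η η' : Fin n → Bool), T.Psi η a → T.Psi η' a → η = η'

/-- The class of structures that defines the Lindström quantifier `Q_𝒜`. -/
def InQ (A : Ordinal.{0} → Set Cantor) : Prop :=
  T.ThetaTL ∧ T.UniqueRep ∧ ∃ α ≤ ω₁, T.Omega ∩ A ω₁ = A α

end TreeModel

/-- Formulas of `L^{d1}_𝒜` in the vocabulary `L` with free variables among `x_0, …, x_{n-1}`:
the closure of the atomic formulas under negation, conjunction, disjunction, first order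
quantification, and the generalized quantifier. A quantifier binds the last variables:
`ex φ` and `all φ` bind `x_n`, and `Q ψ₀ ψ₁ ψ₂ ψ₃ ψ₄` binds `x_n, x_{n+1}` in `ψ₀, ψ₁, ψ₂` and
`x_n` in `ψ₃, ψ₄`. -/
inductive Fml (L : FirstOrder.Language.{u, v}) : ℕ → Type (max u v)
  | eq {n : ℕ} (s t : L.Term (Fin n)) : Fml L n
  | rel {n l : ℕ} (R : L.Relations l) (ts : Fin l → L.Term (Fin n)) : Fml L n
  | not {n : ℕ} (φ : Fml L n) : Fml L n
  | and {n : ℕ} (φ ψ : Fml L n) : Fml L n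
  | or {n : ℕ} (φ ψ : Fml L n) : Fml L n
  | ex {n : ℕ} (φ : Fml L (n + 1)) : Fml L n
  | all {n : ℕ} (φ : Fml L (n + 1)) : Fml L n
  | Q {n : ℕ} (ψ₀ ψ₁ ψ₂ : Fml L (n + 2)) (ψ₃ ψ₄ : Fml L (n + 1)) : Fml L n

namespace Fml

variable {L : FirstOrder.Language.{u, v}}

/-- Truth of a formula in the structure `M` under the assignment `c`. -/
def Realize (A : Ordinal.{0} → Set Cantor) (M : Type w) [L.Structure M] :
    {n : ℕ} → Fml L n → (Fin n → M) → Prop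
  | _, eq s t, c => s.realize c = t.realize c
  | _, rel R ts, c => FirstOrder.Language.Structure.RelMap R fun i => (ts i).realize c
  | _, not φ, c => ¬ Realize A M φ c
  | _, and φ ψ, c => Realize A M φ c ∧ Realize A M ψ c
  | _, or φ ψ, c => Realize A M φ c ∨ Realize A M ψ c
  | _, ex φ, c => ∃ a : M, Realize A M φ (Fin.snoc c a)
  | _, all φ, c => ∀ a : M, Realize A M φ (Fin.snoc c a)
  | _, Q ψ₀ ψ₁ ψ₂ ψ₃ ψ₄, c =>
    TreeModel.InQ (M := M)
      { R₀ := fun a b => Realize A M ψ₀ (Fin.snoc (Fin.snoc c a : Fin (_ + 1) → M) b)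
        R₁ := fun a b => Realize A M ψ₁ (Fin.snoc (Fin.snoc c a : Fin (_ + 1) → M) b)
        R₂ := fun a b => Realize A M ψ₂ (Fin.snoc (Fin.snoc c a : Fin (_ + 1) → M) b)
        R₃ := fun a => Realize A M ψ₃ (Fin.snoc c a)
        R₄ := fun a => Realize A M ψ₄ (Fin.snoc c a) } A

/-- First order formulas: those without the generalized quantifier. -/
inductive IsFirstOrder : {n : ℕ} → Fml L n → Prop
  | eq {n : ℕ} (s t : L.Term (Fin n)) : IsFirstOrder (.eq s t)
  | rel {n l : ℕ} (R : L.Relations l) (ts : Fin l → L.Term (Fin n)) : IsFirstOrder (.rel R ts)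
  | not {n : ℕ} {φ : Fml L n} : IsFirstOrder φ → IsFirstOrder (.not φ)
  | and {n : ℕ} {φ ψ : Fml L n} : IsFirstOrder φ → IsFirstOrder ψ → IsFirstOrder (.and φ ψ)
  | or {n : ℕ} {φ ψ : Fml L n} : IsFirstOrder φ → IsFirstOrder ψ → IsFirstOrder (.or φ ψ)
  | ex {n : ℕ} {φ : Fml L (n + 1)} : IsFirstOrder φ → IsFirstOrder (.ex φ)
  | all {n : ℕ} {φ : Fml L (n + 1)} : IsFirstOrder φ → IsFirstOrder (.all φ)

/-- Formulas of `L^{d0}_𝒜`: the closure of first order logic under `∧`, `∨`, `∃`, `∀` and the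
generalized quantifier. -/
inductive IsD0 : {n : ℕ} → Fml L n → Prop
  | fo {n : ℕ} {φ : Fml L n} : IsFirstOrder φ → IsD0 φ
  | and {n : ℕ} {φ ψ : Fml L n} : IsD0 φ → IsD0 ψ → IsD0 (.and φ ψ)
  | or {n : ℕ} {φ ψ : Fml L n} : IsD0 φ → IsD0 ψ → IsD0 (.or φ ψ)
  | ex {n : ℕ} {φ : Fml L (n + 1)} : IsD0 φ → IsD0 (.ex φ)
  | all {n : ℕ} {φ : Fml L (n + 1)} : IsD0 φ → IsD0 (.all φ)
  | Q {n : ℕ} {ψ₀ ψ₁ ψ₂ : Fml L (n + 2)} {ψ₃ ψ₄ : Fml L (n + 1)} :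
      IsD0 ψ₀ → IsD0 ψ₁ → IsD0 ψ₂ → IsD0 ψ₃ → IsD0 ψ₄ → IsD0 (.Q ψ₀ ψ₁ ψ₂ ψ₃ ψ₄)

end Fml

/-- `N ≼_{L^{d1}_𝒜} M`, for a substructure `N` of `M`. -/
def ElementaryD1 {L : FirstOrder.Language.{u, v}} {M : Type w} [L.Structure M]
    (A : Ordinal.{0} → Set Cantor) (N : L.Substructure M) : Prop :=
  ∀ (n : ℕ) (φ : Fml L n) (c : Fin n → N),
    φ.Realize A N c ↔ φ.Realize A M fun i => (c i : M)

/-- `N ≼_{L^{d0}_𝒜} M`, for a substructure `N` of `M`. -/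
def ElementaryD0 {L : FirstOrder.Language.{u, v}} {M : Type w} [L.Structure M]
    (A : Ordinal.{0} → Set Cantor) (N : L.Substructure M) : Prop :=
  ∀ (n : ℕ) (φ : Fml L n), φ.IsD0 → ∀ c : Fin n → N,
    φ.Realize A N c ↔ φ.Realize A M fun i => (c i : M)

end DensityLogic

/-! Work with sets Z ⊆ M ⊕ ω₁ closed under a finitary operation with countable values. Conditions
met by all such Z form a filter stable under countable and diagonal intersections, so a demand for
witnesses can be imposed for all parameters from Z at once. A closure of a countable set is
countable and commutes with increasing unions, so stationarity yields such a countable Z ⊇ X whose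
trace on ω₁ is an ordinal δ with A_δ = ⋃_{β<δ} A_β (`exists_countable_of_eventually`). The submodel
N is the M-part of Z.

Elementarity is an induction on formulas (`eventually_realize`): Tarski–Vaught for the first order
steps, and `eventually_inQ` for the quantifier. The heart is `eventually_omega`: the reals of A_{ω₁}
represented in the trace are exactly those of Ω(T) ∩ A_δ. By unique representation, an element of Z
represents at most one real, so an index β with that real in A_β can be put into Z, hence below δ.
Conversely, a real of A_δ lies in a countable A_β with β ∈ Z, so if it is represented at all, it is
represented in Z. Thus Ω(T) ∩ A_{ω₁} = A_α cuts down to A_{min(α,δ)}, and failure of every such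
equation is reflected as well. -/

namespace DensityLogic

/-! ### Sets closed under countable-valued finitary operations -/

section ClosureFilter

variable {α : Type*}

/-- `Z` is closed under the set-valued finitary operation `g`. -/
def ClosedUnder (g : List α → Set α) (Z : Set α) : Prop :=
  ∀ l : List α, (∀ x ∈ l, x ∈ Z) → g l ⊆ Z

/-- The filter of families of sets that contain all sets closed under some finitary operation with
countable values. -/
def closureFilter (α : Type*) : Filter (Set α) where
  sets := {F | ∃ g : List α → Set α, (∀ l, (g l).Countable) ∧ ∀ Z, ClosedUnder g Z → Z ∈ F}
  univ_sets := ⟨fun _ => ∅, by simp, by simp⟩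
  sets_of_superset := by
    rintro F G ⟨g, hg, h⟩ hFG
    exact ⟨g, hg, fun Z hZ => hFG (h Z hZ)⟩
  inter_sets := by
    rintro F G ⟨g, hg, h⟩ ⟨g', hg', h'⟩
    refine ⟨fun l => g l ∪ g' l, fun l => (hg l).union (hg' l), fun Z hZ => ⟨h Z ?_, h' Z ?_⟩⟩
    · exact fun l hl => Set.subset_union_left.trans (hZ l hl)
    · exact fun l hl => Set.subset_union_right.trans (hZ l hl)

theorem eventually_closureFilter {P : Set α → Prop} :
    (∀ᶠ Z in closureFilter α, P Z) ↔
      ∃ g : List α → Set α, (∀ l, (g l).Countable) ∧ ∀ Z, ClosedUnder g Z → P Z :=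
  Iff.rfl

/-- Closure under diagonal intersections. -/
theorem eventually_diagonal {κ : Type*} (s : κ → List α) (hs : ∀ l, {k | s k = l}.Countable)
    {P : κ → Set α → Prop} (hP : ∀ k, ∀ᶠ Z in closureFilter α, P k Z) :
    ∀ᶠ Z in closureFilter α, ∀ k, (∀ x ∈ s k, x ∈ Z) → P k Z := by
  simp only [eventually_closureFilter] at hP ⊢
  choose g hg h using hP
  -- The input is read as `s k ++ l`. Every cut position `j` is tried, and only countably many `k`
  -- have the given prefix as `s k`, so the values stay countable.
  refine ⟨fun l => ⋃ j : ℕ, ⋃ k ∈ {k | s k = l.take j}, g k (l.drop j), fun l => ?_, ?_⟩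
  · exact Set.countable_iUnion fun j => (hs _).biUnion fun k _ => hg k _
  · intro Z hZ k hk
    refine h k Z fun l hl x hx => hZ (s k ++ l) ?_ ?_
    · intro y hy
      rcases List.mem_append.1 hy with hy | hy
      exacts [hk y hy, hl y hy]
    · simp only [Set.mem_iUnion]
      exact ⟨(s k).length, k, by simp, by simpa using hx⟩

theorem eventually_forall_countable {ι : Type*} [Countable ι] {P : ι → Set α → Prop}
    (hP : ∀ k, ∀ᶠ Z in closureFilter α, P k Z) : ∀ᶠ Z in closureFilter α, ∀ k, P k Z := by
  filter_upwards [eventually_diagonal (fun _ => []) (fun _ => Set.to_countable _) hP]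
    with Z h k using h k (by simp)

theorem eventually_forall_mem {P : α → Set α → Prop} (hP : ∀ x, ∀ᶠ Z in closureFilter α, P x Z) :
    ∀ᶠ Z in closureFilter α, ∀ x ∈ Z, P x Z := by
  filter_upwards [eventually_diagonal (fun x => [x])
    (fun l => Set.Subsingleton.countable fun x hx y hy => by
      simpa using hx.trans hy.symm) hP] with Z h x hx using h x (by simpa using hx)

theorem eventually_forall_tuple {β : Type*} (i : β → α) (hi : i.Injective) {n : ℕ}
    {P : (Fin n → β) → Set α → Prop} (hP : ∀ c, ∀ᶠ Z in closureFilter α, P c Z) :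
    ∀ᶠ Z in closureFilter α, ∀ c : Fin n → β, (∀ k, i (c k) ∈ Z) → P c Z := by
  filter_upwards [eventually_diagonal (fun c : Fin n → β => List.ofFn (i ∘ c))
    (fun l => Set.Subsingleton.countable fun x hx y hy =>
      hi.comp_left (List.ofFn_injective (hx.trans hy.symm))) hP] with Z h c hc
  exact h c (by simpa [List.mem_ofFn] using hc)

theorem eventually_subset {S : Set α} (hS : S.Countable) : ∀ᶠ Z in closureFilter α, S ⊆ Z :=
  eventually_closureFilter.2 ⟨fun _ => S, fun _ => hS, fun _ hZ => hZ [] (by simp)⟩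

theorem eventually_mem (x : α) : ∀ᶠ Z in closureFilter α, x ∈ Z := by
  filter_upwards [eventually_subset (Set.countable_singleton x)] with Z h using h rfl

/-- One Skolem witness: if `p` has a solution, fix one and require `Z` to contain it. Combined with
the diagonal lemmas, this gives Skolem functions. -/
theorem eventually_exists_tuple {β : Type*} (i : β → α) {n : ℕ} (p : (Fin n → β) → Prop) :
    ∀ᶠ Z in closureFilter α, (∃ c, p c) → ∃ c, (∀ k, i (c k) ∈ Z) ∧ p c := by
  by_cases h : ∃ c, p c
  · obtain ⟨c, hc⟩ := h
    filter_upwards [eventually_forall_countable fun k => eventually_mem (i (c k))] with Z h _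
    exact ⟨c, h, hc⟩
  · exact Filter.Eventually.of_forall fun _ h' => absurd h' h

theorem eventually_exists {β : Type*} (i : β → α) (p : β → Prop) :
    ∀ᶠ Z in closureFilter α, (∃ c, p c) → ∃ c, i c ∈ Z ∧ p c := by
  by_cases h : ∃ c, p c
  · obtain ⟨c, hc⟩ := h
    filter_upwards [eventually_mem (i c)] with Z h _
    exact ⟨c, h, hc⟩
  · exact Filter.Eventually.of_forall fun _ h' => absurd h' h

/-- The least superset of `Y` closed under `g`. -/
inductive Closure (g : List α → Set α) (Y : Set α) : α → Prop
  | base {x : α} (hx : x ∈ Y) : Closure g Y x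
  | step (l : List α) {x : α} (hl : ∀ y ∈ l, Closure g Y y) (hx : x ∈ g l) : Closure g Y x

theorem closedUnder_closure (g : List α → Set α) (Y : Set α) :
    ClosedUnder g {x | Closure g Y x} :=
  fun l hl _ hx => Closure.step l hl hx

theorem Closure.mono {g : List α → Set α} {Y Y' : Set α} (h : Y ⊆ Y') {x : α}
    (hx : Closure g Y x) : Closure g Y' x := by
  induction hx with
  | base hx => exact .base (h hx)
  | step l _ hx ih => exact .step l ih hx

theorem countable_closure {g : List α → Set α} (hg : ∀ l, (g l).Countable) {Y : Set α}
    (hY : Y.Countable) : {x | Closure g Y x}.Countable := by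
  let s : ℕ → Set α := fun n => Nat.rec Y (fun _ t => t ∪ ⋃ l : List t, g (l.map (↑))) n
  have hs : ∀ n, (s n).Countable := by
    intro n
    induction n with
    | zero => exact hY
    | succ n ih =>
      have := ih.to_subtype
      exact ih.union (Set.countable_iUnion fun _ => hg _)
  have mono : Monotone s := monotone_nat_of_le_succ fun n => Set.subset_union_left
  refine (Set.countable_iUnion hs).mono fun x hx => ?_
  rw [Set.mem_ofPred_eq] at hx
  induction hx with
  | base hx => exact Set.mem_iUnion.2 ⟨0, hx⟩
  | @step l x _ hx ih =>
    have : ∃ n, ∀ y ∈ l, y ∈ s n := by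
      clear hx
      induction l with
      | nil => simp
      | cons a l IH =>
        obtain ⟨n, hn⟩ := IH (fun y hy => by simp_all) (fun y hy => ih y (by simp [hy]))
        obtain ⟨m, hm⟩ := Set.mem_iUnion.1 (ih a (by simp))
        refine ⟨max n m, ?_⟩
        simp only [List.mem_cons, forall_eq_or_imp]
        exact ⟨mono (le_max_right _ _) hm, fun y hy => mono (le_max_left _ _) (hn y hy)⟩
    obtain ⟨n, hn⟩ := this
    refine Set.mem_iUnion.2 ⟨n + 1, Or.inr (Set.mem_iUnion.2 ?_)⟩
    exact ⟨l.attachWith _ hn, by simpa using hx⟩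

/-- The closure depends continuously on the generating set. -/
theorem exists_closure_of_directed {ι : Type*} [LinearOrder ι] {g : List α → Set α}
    {Y : ι → Set α} (hY : Monotone Y) {d : Set ι} (hd : d.Nonempty) {W : Set α}
    (hW : ∀ x ∈ W, ∃ e ∈ d, x ∈ Y e) {x : α} (hx : Closure g W x) :
    ∃ e ∈ d, Closure g (Y e) x := by
  induction hx with
  | base hx =>
    obtain ⟨e, he, h⟩ := hW _ hx
    exact ⟨e, he, .base h⟩
  | @step l x _ hx ih =>
    have : ∃ e ∈ d, ∀ y ∈ l, Closure g (Y e) y := by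
      clear hx
      induction l with
      | nil => exact hd.imp fun e he => ⟨he, by simp⟩
      | cons a l IH =>
        obtain ⟨e, he, h⟩ := IH (fun y hy => by simp_all) (fun y hy => ih y (by simp [hy]))
        obtain ⟨e', he', h'⟩ := ih a (by simp)
        -- Only finitely many stages are involved, so the latest of them serves the whole list.
        refine ⟨max e e', by rcases max_choice e e' with h | h <;> rwa [h], ?_⟩
        simp only [List.mem_cons, forall_eq_or_imp]
        exact ⟨h'.mono (hY (le_max_right _ _)), fun y hy => (h y hy).mono (hY (le_max_left _ _))⟩
    obtain ⟨e, he, h⟩ := this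
    exact ⟨e, he, .step l h hx⟩

end ClosureFilter

/-! ### Countable ordinals and stationary traces -/

/-- The countable ordinals. -/
abbrev Countables : Type 1 := Set.Iio (ω₁ : Ordinal.{0})

theorem Countables.exists_bound {s : Set Countables} (hs : s.Countable) :
    ∃ γ : Countables, ∀ β ∈ s, β < γ := by
  have := hs.to_subtype
  have h : (⨆ β : s, Order.succ (β : Ordinal.{0})) < ω₁ :=
    Ordinal.iSup_lt_omega_one fun β =>
      (Cardinal.isSuccLimit_omega 1).succ_lt β.1.2
  refine ⟨⟨_, h⟩, fun β hβ => ?_⟩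
  refine Subtype.mk_lt_mk.2 (lt_of_lt_of_le (Order.lt_succ β.1) ?_)
  exact Ordinal.le_iSup (fun β : s => Order.succ (β : Ordinal.{0})) ⟨β, hβ⟩

theorem Countables.countable_Iio (γ : Countables) : (Set.Iio γ).Countable := by
  have h : (Set.Iio (γ : Ordinal.{0})).Countable := by
    have hγ : (γ : Ordinal.{0}) < (Cardinal.aleph 1).ord := by
      rw [Cardinal.ord_aleph]
      exact γ.2
    rw [Cardinal.lt_ord, ← Cardinal.succ_aleph0, Order.lt_succ_iff] at hγ
    rw [← Cardinal.le_aleph0_iff_set_countable, Cardinal.mk_Iio_ordinal, Cardinal.lift_le_aleph0]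
    exact hγ
  exact h.preimage Subtype.val_injective

theorem Countables.exists_isLUB {s : Set Countables} (hs : s.Countable) : ∃ γ, IsLUB s γ := by
  obtain ⟨γ, hγ⟩ := exists_bound hs
  have hne : (upperBounds s).Nonempty := ⟨γ, fun β hβ => (hγ β hβ).le⟩
  exact ⟨_, WellFounded.min_mem wellFounded_lt _ hne,
    fun β hβ => WellFounded.min_le wellFounded_lt hβ⟩

/-- A family of sets in the closure filter has a countable member whose trace on the countable
ordinals is an ordinal from a prescribed stationary set. -/
theorem exists_countable_of_eventually {M : Type w} {S : Set Countables} (hS : IsStationary S)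
    {X : Set M} (hX : X.Countable) {P : Set (M ⊕ Countables) → Prop}
    (hP : ∀ᶠ Z in closureFilter (M ⊕ Countables), P Z) :
    ∃ Z, P Z ∧ Z.Countable ∧ Sum.inl '' X ⊆ Z ∧ ∃ δ ∈ S, ∀ β, Sum.inr β ∈ Z ↔ β < δ := by
  obtain ⟨g, hg, h⟩ := eventually_closureFilter.1 hP
  let Y : Countables → Set (M ⊕ Countables) := fun δ => Sum.inl '' X ∪ Sum.inr '' Set.Iio δ
  have hY : Monotone Y := fun a b hab =>
    Set.union_subset_union_right _ (Set.image_mono (Set.Iio_subset_Iio hab))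
  have hYc : ∀ δ, (Y δ).Countable := fun δ => (hX.image _).union ((δ.countable_Iio).image _)
  have key : ∀ {d : Set Countables} {a : Countables}, d.Nonempty → IsLUB d a → ∀ x,
      Closure g (Y a) x → ∃ e ∈ d, Closure g (Y e) x := by
    intro d a hd ha x hx
    refine exists_closure_of_directed hY hd ?_ hx
    rintro _ (hy | ⟨γ, hγ, rfl⟩)
    · exact hd.imp fun e he => ⟨he, .inl hy⟩
    · obtain ⟨e, he, hlt⟩ := (lt_isLUB_iff ha).1 hγ
      exact ⟨e, he, .inr ⟨γ, hlt, rfl⟩⟩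
  -- These are the δ for which closing up `X` together with the ordinals below δ adds no ordinal ≥
  -- δ.
  have hclub : IsClub {δ | ∀ β, Closure g (Y δ) (Sum.inr β) → β < δ} := by
    refine ⟨fun d hd hne _ a ha β hβ => ?_, fun δ₀ => ?_⟩
    · obtain ⟨e, he, h⟩ := key hne ha _ hβ
      exact (hd he β h).trans_le (ha.1 he)
    · have : ∀ δ, ∃ γ, ∀ β, Closure g (Y δ) (Sum.inr β) → β < γ := fun δ =>
        Countables.exists_bound
          ((countable_closure hg (hYc δ)).preimage Sum.inr_injective)
      choose f hf using this
      -- An ordinal in the closure at the supremum `a` already appears at some iterate, hence lies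
      -- below the next one.
      obtain ⟨a, ha⟩ := Countables.exists_isLUB (Set.countable_range fun n : ℕ => f^[n] δ₀)
      refine ⟨a, fun β hβ => ?_, ha.1 ⟨0, rfl⟩⟩
      obtain ⟨_, ⟨n, rfl⟩, h⟩ := key (Set.range_nonempty _) ha _ hβ
      refine (hf _ β h).trans_le (ha.1 ⟨n + 1, ?_⟩)
      exact Function.iterate_succ_apply' f n δ₀
  obtain ⟨δ, hδS, hδ⟩ := hS hclub
  refine ⟨{x | Closure g (Y δ) x}, h _ (closedUnder_closure _ _), countable_closure hg (hYc δ),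
    fun x hx => .base (.inl hx), δ, hδS, fun β => ⟨hδ β, fun h => .base (.inr ⟨β, h, rfl⟩)⟩⟩

/-! ### Tree-likeness and unique representation in the trace -/

namespace TreeModel

variable {K M : Type w} (T : TreeModel M)

/-- The pullback of a structure along a map. -/
def comap (f : K → M) : TreeModel K where
  R₀ a b := T.R₀ (f a) (f b)
  R₁ a b := T.R₁ (f a) (f b)
  R₂ a b := T.R₂ (f a) (f b)
  R₃ a := T.R₃ (f a)
  R₄ a := T.R₄ (f a)

theorem comap_edge (f : K → M) (b : Bool) (x y : K) :
    (T.comap f).edge b x y ↔ T.edge b (f x) (f y) := by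
  cases b <;> rfl

/-- The universal part of `Θ_TL`. -/
def TreeAxioms (x y z : M) : Prop :=
  (T.R₀ x y → T.R₂ x y) ∧ (T.R₁ x y → T.R₂ x y) ∧ (T.R₂ x y → T.R₄ x ∧ T.R₄ y) ∧
  (T.R₄ x → T.R₂ x x) ∧ (T.R₂ x y → T.R₂ y z → T.R₂ x z) ∧
  (T.R₂ y x → T.R₂ z x → T.R₂ y z ∨ T.R₂ z y)

theorem thetaTL_iff : T.ThetaTL ↔
    (∃ x, T.R₃ x ∧ ∀ y, T.R₄ y → T.R₂ x y) ∧ ∀ c : Fin 3 → M, T.TreeAxioms (c 0) (c 1) (c 2) := by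
  refine and_congr_right fun _ => ⟨fun ⟨h₀, h₁, h₂, h₃, h₄, h₅⟩ c =>
    ⟨h₀ _ _, h₁ _ _, h₂ _ _, h₃ _, h₄ _ _ _, h₅ _ _ _⟩, fun h => ?_⟩
  have h' : ∀ x y z, T.TreeAxioms x y z := fun x y z => h ![x, y, z]
  exact ⟨fun x y => (h' x y x).1, fun x y => (h' x y x).2.1, fun x y => (h' x y x).2.2.1,
    fun x => (h' x x x).2.2.2.1, fun x y z => (h' x y z).2.2.2.2.1,
    fun x y z => (h' x y z).2.2.2.2.2⟩

/-- `f` maps onto the `M`-part of `Z`. -/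
def IsTrace {κ : Type*} (f : K → M) (Z : Set (M ⊕ κ)) : Prop :=
  ∀ a, Sum.inl a ∈ Z ↔ ∃ k, f k = a

theorem IsTrace.exists_iff {κ : Type*} {f : K → M} {Z : Set (M ⊕ κ)} (h : IsTrace f Z)
    {p : M → Prop} : (∃ a, Sum.inl a ∈ Z ∧ p a) ↔ ∃ k, p (f k) := by
  constructor
  · rintro ⟨a, ha, hp⟩
    obtain ⟨k, rfl⟩ := (h a).1 ha
    exact ⟨k, hp⟩
  · rintro ⟨k, hk⟩
    exact ⟨f k, (h _).2 ⟨k, rfl⟩, hk⟩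

theorem IsTrace.exists_tuple_iff {κ : Type*} {f : K → M} {Z : Set (M ⊕ κ)} (h : IsTrace f Z)
    {n : ℕ} {p : (Fin n → M) → Prop} :
    (∃ c, (∀ i, Sum.inl (c i) ∈ Z) ∧ p c) ↔ ∃ k : Fin n → K, p (f ∘ k) := by
  constructor
  · rintro ⟨c, hc, hp⟩
    choose k hk using fun i => (h (c i)).1 (hc i)
    exact ⟨k, by rwa [show f ∘ k = c from funext hk]⟩
  · rintro ⟨k, hk⟩
    exact ⟨f ∘ k, fun i => (h _).2 ⟨k i, rfl⟩, hk⟩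

open Sum in
-- Apart from the root, the axioms are universal in three variables: they pass to subsets, and a
-- failure is witnessed by one triple placed in `Z`.
theorem eventually_thetaTL (κ : Type*) : ∀ᶠ Z in closureFilter (M ⊕ κ),
    ∀ {K : Type w} (f : K → M), IsTrace f Z → ((T.comap f).ThetaTL ↔ T.ThetaTL) := by
  filter_upwards [eventually_exists (α := M ⊕ κ) inl fun x => T.R₃ x ∧ ∀ y, T.R₄ y → T.R₂ x y,
    -- Each non-root in `Z` satisfying or not `R₃` gets a `y` in `Z` refuting it as lower bound, so
    -- that a root of the trace is a root of `M`.
    eventually_forall_mem fun u : M ⊕ κ => eventually_exists (α := M ⊕ κ) inl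
      fun y => ∃ x, u = inl x ∧ ¬ (T.R₄ y → T.R₂ x y),
    eventually_exists_tuple (α := M ⊕ κ) inl
      fun c : Fin 3 → M => ¬ T.TreeAxioms (c 0) (c 1) (c 2)] with Z h₁ h₂ h₃ K f hf
  rw [thetaTL_iff, thetaTL_iff]
  refine and_congr ⟨?_, fun h => ?_⟩ ⟨fun h => ?_, fun h c => h (f ∘ c)⟩
  · rintro ⟨k, hk, hy⟩
    refine ⟨f k, hk, ?_⟩
    by_contra! hcon
    obtain ⟨y, hy'⟩ := hcon
    have := h₂ (inl (f k)) ((hf _).2 ⟨k, rfl⟩) ⟨y, f k, rfl, by simpa using hy'⟩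
    rw [hf.exists_iff] at this
    obtain ⟨y, x, hx, h⟩ := this
    cases hx
    exact h (hy y)
  · obtain ⟨k, hk⟩ := hf.exists_iff.1 (h₁ h)
    exact ⟨k, hk.1, fun y => hk.2 (f y)⟩
  · by_contra! hcon
    obtain ⟨k, hk⟩ := hf.exists_tuple_iff.1 (h₃ hcon)
    exact hk (h k)

open Sum in
-- Representation of a finite sequence is existential and there are countably many finite sequences,
-- so it suffices that `Z` contains a witnessing branch for each of its elements.
theorem eventually_psi (κ : Type*) : ∀ᶠ Z in closureFilter (M ⊕ κ),
    ∀ {K : Type w} (f : K → M), IsTrace f Z → ∀ {n : ℕ} (η : Fin n → Bool) (k : K),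
      (T.comap f).Psi η k ↔ T.Psi η (f k) := by
  have := eventually_forall_countable fun n : ℕ => eventually_forall_countable
    fun η : Fin n → Bool => eventually_forall_mem fun u : M ⊕ κ =>
    eventually_exists_tuple (α := M ⊕ κ) inl fun y : Fin (n + 1) → M => ∃ x, u = inl x ∧
      T.R₃ (y 0) ∧ (∀ i, T.R₄ (y i)) ∧
      (∀ i : Fin n, T.edge (η i) (y i.castSucc) (y i.succ)) ∧ ∀ i, T.R₂ (y i) x
  filter_upwards [this] with Z h K f hf n η k
  refine and_congr_right fun _ => ⟨?_, ?_⟩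
  · rintro ⟨y, h₀, h₁, h₂, h₃⟩
    exact ⟨f ∘ y, h₀, h₁, fun i => (T.comap_edge f _ _ _).1 (h₂ i), h₃⟩
  · rintro ⟨y, hy⟩
    obtain ⟨y, x, hx, h₀, h₁, h₂, h₃⟩ := hf.exists_tuple_iff.1
      (h n η (inl (f k)) ((hf _).2 ⟨k, rfl⟩) ⟨y, _, rfl, hy⟩)
    cases hx
    exact ⟨y, h₀, h₁, fun i => (T.comap_edge f _ _ _).2 (h₂ i), h₃⟩

open Sum in
theorem eventually_uniqueRep (κ : Type*) : ∀ᶠ Z in closureFilter (M ⊕ κ),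
    ∀ {K : Type w} (f : K → M), IsTrace f Z → ((T.comap f).UniqueRep ↔ T.UniqueRep) := by
  filter_upwards [T.eventually_psi κ, eventually_exists (α := M ⊕ κ) inl
    fun a => ¬ ∀ (n : ℕ) (η η' : Fin n → Bool), T.Psi η a → T.Psi η' a → η = η'] with Z h₁ h₂ K f hf
  simp only [UniqueRep, h₁ f hf]
  refine ⟨fun h => ?_, fun h a => h _⟩
  by_contra! hcon
  obtain ⟨k, hk⟩ := hf.exists_iff.1 (h₂ (by simpa using hcon))
  exact hk (h k)

theorem UniqueRep.eq_of_psi {T : TreeModel M} (hT : T.UniqueRep) {a : M} {η η' : Cantor}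
    (h : ∀ n : ℕ, T.Psi (fun i : Fin n => η i) a) (h' : ∀ n : ℕ, T.Psi (fun i : Fin n => η' i) a) :
    η = η' :=
  funext fun k => congrFun (hT a (k + 1) _ _ (h _) (h' _)) (Fin.last k)

end TreeModel

/-! ### The represented reals in the trace -/

/-- The set of indices at which the sequence is continuous. -/
abbrev continuityPoints (A : Ordinal.{0} → Set Cantor) : Set Countables :=
  {α : Countables | A α = ⋃ β < (α : Ordinal.{0}), A β}

theorem IsDenseSequence.subset {A : Ordinal.{0} → Set Cantor} (hA : IsDenseSequence A)
    {α β : Ordinal.{0}} (h : α ≤ β) (hβ : β ≤ ω₁) : A α ⊆ A β := by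
  rcases h.eq_or_lt with rfl | h
  exacts [subset_rfl, hA.mono _ _ h hβ]

theorem IsDenseSequence.mem_top {A : Ordinal.{0} → Set Cantor} (hA : IsDenseSequence A)
    {η : Cantor} : η ∈ A ω₁ ↔ ∃ β : Countables, η ∈ A β := by
  rw [hA.top_eq]
  simp [Countables]

namespace TreeModel

variable {K M : Type w} (T : TreeModel M)

open Sum in
/-- Reals represented in `M` and lying in `A_β` are represented by elements of `Z`. -/
theorem eventually_exists_rep {A : Ordinal.{0} → Set Cantor} (hA : IsDenseSequence A) :
    ∀ᶠ Z in closureFilter (M ⊕ Countables), ∀ β : Countables, inr β ∈ Z → ∀ η ∈ A β ∩ T.Omega,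
      ∃ a, inl a ∈ Z ∧ ∀ n : ℕ, T.Psi (fun i : Fin n => η i) a := by
  have := eventually_forall_tuple (n := 1) (inr : Countables → M ⊕ Countables) inr_injective
    (P := fun β Z => ∀ η : A (β 0), η.1 ∈ T.Omega →
      ∃ a, inl a ∈ Z ∧ ∀ n : ℕ, T.Psi (fun i : Fin n => η.1 i) a) fun β => by
    -- Countability of `A β` leaves only countably many witnesses to add for each β.
    have := (hA.countable _ (β 0).2).to_subtype
    exact eventually_forall_countable fun η => eventually_exists inl _
  filter_upwards [this] with Z h β hβ η hη
  exact h (fun _ => β) (fun _ => hβ) ⟨η, hη.1⟩ hη.2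

open Sum in
/-- The ranks of the reals represented by elements of `Z` belong to `Z`. -/
theorem eventually_exists_rank {A : Ordinal.{0} → Set Cantor} (hA : IsDenseSequence A)
    (hT : T.UniqueRep) :
    ∀ᶠ Z in closureFilter (M ⊕ Countables), ∀ a, inl a ∈ Z → ∀ η ∈ A ω₁,
      (∀ n : ℕ, T.Psi (fun i : Fin n => η i) a) → ∃ β : Countables, inr β ∈ Z ∧ η ∈ A β := by
  filter_upwards [eventually_forall_mem fun u : M ⊕ Countables =>
    eventually_exists (inr : Countables → M ⊕ Countables) fun β => ∃ a, u = inl a ∧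
      ∃ η ∈ A β, ∀ n : ℕ, T.Psi (fun i : Fin n => η i) a] with Z h a ha η hη hrep
  obtain ⟨β, hβ⟩ := hA.mem_top.1 hη
  obtain ⟨γ, hγ, b, hb, η', hη', hrep'⟩ := h _ ha ⟨β, a, rfl, η, hβ, hrep⟩
  cases hb
  -- The index γ was chosen for some real represented by `a`; unique representation identifies it
  -- with η.
  exact ⟨γ, hγ, hT.eq_of_psi hrep hrep' ▸ hη'⟩

open Sum in
theorem eventually_omega {A : Ordinal.{0} → Set Cantor} (hA : IsDenseSequence A)
    (hT : T.UniqueRep) : ∀ᶠ Z in closureFilter (M ⊕ Countables),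
    ∀ δ ∈ continuityPoints A, (∀ β, inr β ∈ Z ↔ β < δ) →
    ∀ {K : Type w} (f : K → M), IsTrace f Z →
      ((∃ α ≤ ω₁, (T.comap f).Omega ∩ A ω₁ = A α) ↔ ∃ α ≤ ω₁, T.Omega ∩ A ω₁ = A α) := by
  filter_upwards [T.eventually_psi Countables, T.eventually_exists_rep hA,
    T.eventually_exists_rank hA hT,
    -- If some real of A_{ω₁} distinguishes Ω(T) from A_β with β ∈ Z, then one does so in a level
    -- A_γ with γ ∈ Z. The index ω₁ is not an element of `Countables` and needs the separate clause
    -- that follows.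
    eventually_forall_mem fun u : M ⊕ Countables =>
      eventually_exists (inr : Countables → M ⊕ Countables) fun γ => ∃ β : Countables, u = inr β ∧
        ∃ η ∈ A γ, ¬ (η ∈ T.Omega ↔ η ∈ A β),
    eventually_exists (inr : Countables → M ⊕ Countables) fun γ => ∃ η ∈ A γ, η ∉ T.Omega]
    with Z hpsi hrep hrank hne htop δ hδ hZ K f hf
  -- Continuity at δ enters here.
  have hmem : ∀ η, η ∈ A δ ↔ ∃ β : Countables, inr β ∈ Z ∧ η ∈ A β := by
    intro η
    rw [show A δ = _ from hδ]
    simp only [hZ, Set.mem_iUnion]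
    constructor
    · rintro ⟨β, hβ, h⟩
      exact ⟨⟨β, hβ.trans δ.2⟩, hβ, h⟩
    · rintro ⟨β, hβ, h⟩
      exact ⟨β, hβ, h⟩
  have hδω : A δ ⊆ A ω₁ := hA.subset δ.2.le le_rfl
  have hOmega : (T.comap f).Omega ∩ A ω₁ = T.Omega ∩ A δ := by
    ext η
    simp only [Omega, hpsi f hf, Set.mem_inter_iff, Set.mem_ofPred_eq]
    constructor
    · rintro ⟨⟨k, hk⟩, hη⟩
      exact ⟨⟨f k, hk⟩, (hmem η).2 (hrank _ ((hf _).2 ⟨k, rfl⟩) η hη hk)⟩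
    · rintro ⟨h, hη⟩
      obtain ⟨β, hβ, hηβ⟩ := (hmem η).1 hη
      exact ⟨hf.exists_iff.1 (hrep β hβ η ⟨hηβ, h⟩), hδω hη⟩
  rw [hOmega]
  constructor
  · rintro ⟨α, hα, h⟩
    rcases lt_or_ge α δ with hlt | hge
    -- Now α ∈ Z, so a real separating Ω(T) from A_α can be found in A_δ, where the two sets agree.
    · refine ⟨α, hα, ?_⟩
      by_contra hcon
      have hex : ∃ γ : Countables, ∃ η ∈ A γ, ¬ (η ∈ T.Omega ↔ η ∈ A α) := by
        by_contra! hall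
        refine hcon (Set.ext fun η => ?_)
        by_cases hη : η ∈ A ω₁
        · obtain ⟨γ, hγ⟩ := hA.mem_top.1 hη
          simpa [hη] using hall γ η hγ
        · exact iff_of_false (fun h => hη h.2) fun h => hη (hA.subset hα le_rfl h)
      obtain ⟨γ, η, hη, hiff⟩ := hex
      obtain ⟨γ, hγ, β, hβ, η, hη, hiff⟩ := hne (inr ⟨α, hlt.trans δ.2⟩) ((hZ _).2 hlt)
        ⟨γ, _, rfl, η, hη, hiff⟩
      cases hβ
      have hηδ : η ∈ A δ := (hmem η).2 ⟨γ, hγ, hη⟩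
      have := Set.ext_iff.1 h η
      simp only [Set.mem_inter_iff, hηδ, and_true] at this
      exact hiff this
    -- Here A_δ ⊆ A_α ⊆ Ω(T), while a real of A_{ω₁} outside Ω(T) would yield one in A_δ.
    · refine ⟨ω₁, le_rfl, ?_⟩
      rw [Set.inter_eq_right]
      intro η hη
      by_contra hcon
      obtain ⟨γ, hγ⟩ := hA.mem_top.1 hη
      obtain ⟨γ, hγ, η, hη, hnot⟩ := htop ⟨γ, η, hγ, hcon⟩
      have : η ∈ A α := hA.subset hge hα ((hmem η).2 ⟨γ, hγ, hη⟩)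
      rw [← h] at this
      exact hnot this.1
  · rintro ⟨α, hα, h⟩
    have : T.Omega ∩ A δ = A α ∩ A δ := by
      rw [← h, Set.inter_assoc, Set.inter_eq_right.2 hδω]
    rcases le_total α δ with hle | hle
    · exact ⟨α, hα, this.trans (Set.inter_eq_left.2 (hA.subset hle δ.2.le))⟩
    · exact ⟨δ, δ.2.le, this.trans (Set.inter_eq_right.2 (hA.subset hle hα))⟩

theorem eventually_inQ {A : Ordinal.{0} → Set Cantor} (hA : IsDenseSequence A) :
    ∀ᶠ Z in closureFilter (M ⊕ Countables),
    ∀ δ ∈ continuityPoints A, (∀ β, Sum.inr β ∈ Z ↔ β < δ) →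
    ∀ {K : Type w} (f : K → M), IsTrace f Z → ((T.comap f).InQ A ↔ T.InQ A) := by
  -- Without unique representation `eventually_omega` is not available, but then the trace violates
  -- it too and both sides are false.
  by_cases hT : T.UniqueRep
  · filter_upwards [T.eventually_thetaTL Countables, T.eventually_uniqueRep Countables,
      T.eventually_omega hA hT] with Z h₁ h₂ h₃ δ hδ hZ K f hf
    exact and_congr (h₁ f hf) (and_congr (h₂ f hf) (h₃ δ hδ hZ f hf))
  · filter_upwards [T.eventually_uniqueRep Countables] with Z h δ hδ hZ K f hf
    exact iff_of_false (fun hQ => hT ((h f hf).1 hQ.2.1)) fun hQ => hT hQ.2.1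

end TreeModel

/-! ### Countability of the set of formulas -/

namespace Fml

variable {L : FirstOrder.Language.{u, v}}

/-- The nesting depth of a formula. -/
def depth : {n : ℕ} → Fml L n → ℕ
  | _, eq _ _ => 0
  | _, rel _ _ => 0
  | _, not φ => depth φ + 1
  | _, and φ ψ => max (depth φ) (depth ψ) + 1
  | _, or φ ψ => max (depth φ) (depth ψ) + 1
  | _, ex φ => depth φ + 1
  | _, all φ => depth φ + 1
  | _, Q ψ₀ ψ₁ ψ₂ ψ₃ ψ₄ =>
    max (max (depth ψ₀) (depth ψ₁)) (max (depth ψ₂) (max (depth ψ₃) (depth ψ₄))) + 1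

/-- The induction on depth runs over all `n` simultaneously because binders raise the number of free
variables. -/
theorem countable_depth_lt [Countable L.Symbols] (k n : ℕ) :
    {φ : Fml L n | φ.depth < k}.Countable := by
  induction k generalizing n with
  | zero => simp
  | succ k ih =>
    have := fun n => (ih n).to_subtype
    have hc : (Set.range (fun p : L.Term (Fin n) × L.Term (Fin n) => eq p.1 p.2) ∪
      Set.range (fun p : Σ l : ℕ, Σ _ : L.Relations l, Fin l → L.Term (Fin n) =>
        rel p.2.1 p.2.2) ∪
      Set.range (fun p : {φ : Fml L n | φ.depth < k} => not p.1) ∪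
      Set.range (fun p : {φ : Fml L n | φ.depth < k} × {φ : Fml L n | φ.depth < k} =>
        and p.1.1 p.2.1) ∪
      Set.range (fun p : {φ : Fml L n | φ.depth < k} × {φ : Fml L n | φ.depth < k} =>
        or p.1.1 p.2.1) ∪
      Set.range (fun p : {φ : Fml L (n + 1) | φ.depth < k} => ex p.1) ∪
      Set.range (fun p : {φ : Fml L (n + 1) | φ.depth < k} => all p.1) ∪
      Set.range (fun p : {φ : Fml L (n + 2) | φ.depth < k} × {φ : Fml L (n + 2) | φ.depth < k} ×
          {φ : Fml L (n + 2) | φ.depth < k} × {φ : Fml L (n + 1) | φ.depth < k} ×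
          {φ : Fml L (n + 1) | φ.depth < k} =>
        Q p.1.1 p.2.1.1 p.2.2.1.1 p.2.2.2.1.1 p.2.2.2.2.1)).Countable := by
      have hrel : Countable (Σ l : ℕ, L.Relations l) :=
        (Sum.inr_injective (α := Σ l, L.Functions l)).countable (β := L.Symbols)
      have : ∀ l, Countable (L.Relations l) := fun l =>
        (sigma_mk_injective (β := L.Relations) (i := l)).countable
      simp only [Set.countable_union, Set.countable_range, and_self]
    refine hc.mono fun φ hφ => ?_
    simp only [Set.mem_ofPred_eq, Nat.lt_succ_iff] at hφ
    cases φ with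
    | eq s t => exact .inl (.inl (.inl (.inl (.inl (.inl (.inl ⟨(s, t), rfl⟩))))))
    | rel R ts => exact .inl (.inl (.inl (.inl (.inl (.inl (.inr ⟨⟨_, R, ts⟩, rfl⟩))))))
    | not φ => exact .inl (.inl (.inl (.inl (.inl (.inr ⟨⟨φ, hφ⟩, rfl⟩)))))
    | and φ ψ =>
      obtain ⟨h, h'⟩ := max_lt_iff.1 (Nat.lt_of_succ_le hφ)
      exact .inl (.inl (.inl (.inl (.inr ⟨⟨⟨φ, h⟩, ⟨ψ, h'⟩⟩, rfl⟩))))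
    | or φ ψ =>
      obtain ⟨h, h'⟩ := max_lt_iff.1 (Nat.lt_of_succ_le hφ)
      exact .inl (.inl (.inl (.inr ⟨⟨⟨φ, h⟩, ⟨ψ, h'⟩⟩, rfl⟩)))
    | ex φ => exact .inl (.inl (.inr ⟨⟨φ, hφ⟩, rfl⟩))
    | all φ => exact .inl (.inr ⟨⟨φ, hφ⟩, rfl⟩)
    | Q ψ₀ ψ₁ ψ₂ ψ₃ ψ₄ =>
      have h := Nat.lt_of_succ_le hφ
      simp only [max_lt_iff] at h
      obtain ⟨⟨h₀, h₁⟩, h₂, h₃, h₄⟩ := h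
      exact .inr ⟨⟨⟨ψ₀, h₀⟩, ⟨ψ₁, h₁⟩, ⟨ψ₂, h₂⟩, ⟨ψ₃, h₃⟩, ⟨ψ₄, h₄⟩⟩, rfl⟩

instance [Countable L.Symbols] (n : ℕ) : Countable (Fml L n) := by
  rw [← Set.countable_univ_iff]
  refine (Set.countable_iUnion fun k => countable_depth_lt (L := L) k n).mono fun φ _ => ?_
  exact Set.mem_iUnion.2 ⟨φ.depth + 1, Nat.lt_succ_self _⟩

end Fml

/-! ### Elementarity of the trace -/

variable {L : FirstOrder.Language.{u, v}} {M : Type w} [L.Structure M]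

open TreeModel

theorem snoc_coe {N K : Type*} (f : N → K) {n : ℕ} (c : Fin n → N) (a : N) :
    (fun i => f (Fin.snoc (α := fun _ => N) c a i)) =
      Fin.snoc (α := fun _ => K) (fun i => f (c i)) (f a) :=
  Fin.comp_snoc f c a

open Sum in
theorem eventually_realize {A : Ordinal.{0} → Set Cantor} (hA : IsDenseSequence A) {n : ℕ}
    (φ : Fml L n) : ∀ᶠ Z in closureFilter (M ⊕ Countables),
    ∀ δ ∈ continuityPoints A, (∀ β, inr β ∈ Z ↔ β < δ) →
    ∀ N : L.Substructure M, IsTrace (Subtype.val : N → M) Z → ∀ c : Fin n → N,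
      φ.Realize A N c ↔ φ.Realize A M fun i => (c i : M) := by
  induction φ with
  | eq s t =>
    refine .of_forall fun Z δ hδ hZ N hN c => ?_
    rw [Fml.Realize, Fml.Realize, ← Subtype.coe_inj]
    have := fun t : L.Term _ => FirstOrder.Language.HomClass.realize_term N.subtype (t := t) (v := c)
    exact Eq.congr (this s).symm (this t).symm
  | rel R ts =>
    refine .of_forall fun Z δ hδ hZ N hN c => ?_
    rw [Fml.Realize, Fml.Realize]
    have := fun t : L.Term _ => FirstOrder.Language.HomClass.realize_term N.subtype (t := t) (v := c)
    rw [← N.subtype.map_rel]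
    exact iff_of_eq (congrArg _ (funext fun i => (this (ts i)).symm))
  | not φ ih =>
    filter_upwards [ih] with Z h δ hδ hZ N hN c
    exact not_congr (h δ hδ hZ N hN c)
  | and φ ψ ih ih' =>
    filter_upwards [ih, ih'] with Z h h' δ hδ hZ N hN c
    exact and_congr (h δ hδ hZ N hN c) (h' δ hδ hZ N hN c)
  | or φ ψ ih ih' =>
    filter_upwards [ih, ih'] with Z h h' δ hδ hZ N hN c
    exact or_congr (h δ hδ hZ N hN c) (h' δ hδ hZ N hN c)
  | @ex n φ ih =>
    filter_upwards [ih, eventually_forall_tuple (n := n) (inl : M → M ⊕ Countables) inl_injective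
      fun c => eventually_exists inl fun a => φ.Realize A M (Fin.snoc c a)]
      with Z h hex δ hδ hZ N hN c
    simp only [Fml.Realize, h δ hδ hZ N hN, snoc_coe]
    refine ⟨fun ⟨a, ha⟩ => ⟨_, ha⟩, fun ha => ?_⟩
    exact hN.exists_iff.1 (hex (fun i => c i) (fun i => (hN _).2 ⟨c i, rfl⟩) ha)
  | @all n φ ih =>
    filter_upwards [ih, eventually_forall_tuple (n := n) (inl : M → M ⊕ Countables) inl_injective
      fun c => eventually_exists inl fun a => ¬ φ.Realize A M (Fin.snoc c a)]
      with Z h hex δ hδ hZ N hN c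
    simp only [Fml.Realize, h δ hδ hZ N hN, snoc_coe]
    refine ⟨fun ha => ?_, fun ha a => ha a⟩
    by_contra! hcon
    obtain ⟨a, ha'⟩ := hN.exists_iff.1
      (hex (fun i => c i) (fun i => (hN _).2 ⟨c i, rfl⟩) hcon)
    exact ha' (ha a)
  | @Q n ψ₀ ψ₁ ψ₂ ψ₃ ψ₄ ih₀ ih₁ ih₂ ih₃ ih₄ =>
    filter_upwards [ih₀, ih₁, ih₂, ih₃, ih₄,
      -- The defined structure depends on the parameters `c`, whence the diagonal intersection over
      -- tuples. By the induction hypotheses, the structure defined in `N` is the `comap` of the one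
      -- defined in `M`.
      eventually_forall_tuple (n := n) (inl : M → M ⊕ Countables) inl_injective fun c =>
        eventually_inQ
          { R₀ := fun a b => ψ₀.Realize A M (Fin.snoc (Fin.snoc c a : Fin (_ + 1) → M) b)
            R₁ := fun a b => ψ₁.Realize A M (Fin.snoc (Fin.snoc c a : Fin (_ + 1) → M) b)
            R₂ := fun a b => ψ₂.Realize A M (Fin.snoc (Fin.snoc c a : Fin (_ + 1) → M) b)
            R₃ := fun a => ψ₃.Realize A M (Fin.snoc c a)
            R₄ := fun a => ψ₄.Realize A M (Fin.snoc c a) } hA]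
      with Z h₀ h₁ h₂ h₃ h₄ hQ δ hδ hZ N hN c
    simp only [Fml.Realize, h₀ δ hδ hZ N hN, h₁ δ hδ hZ N hN, h₂ δ hδ hZ N hN, h₃ δ hδ hZ N hN,
      h₄ δ hδ hZ N hN, snoc_coe]
    exact hQ (fun i => c i) (fun i => (hN _).2 ⟨c i, rfl⟩) δ hδ hZ _ hN

open Sum in
theorem eventually_exists_substructure [Countable L.Symbols] (κ : Type*) :
    ∀ᶠ Z in closureFilter (M ⊕ κ), ∃ N : L.Substructure M, (N : Set M) = inl ⁻¹' Z := by
  have hf : Countable (Σ l : ℕ, L.Functions l) :=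
    FirstOrder.Language.Countable.countable_functions
  filter_upwards [eventually_forall_countable fun F : Σ l : ℕ, L.Functions l =>
    eventually_forall_tuple (n := F.1) (inl : M → M ⊕ κ) inl_injective fun c =>
      eventually_mem (inl (FirstOrder.Language.Structure.funMap F.2 c))] with Z h
  exact ⟨⟨inl ⁻¹' Z, fun {n} F c hc => h ⟨n, F⟩ c hc⟩, rfl⟩

end DensityLogic

theorem mainTheorem12 {L : FirstOrder.Language.{u, v}} [Countable L.Symbols] {M : Type w} [L.Structure M]
    (A : Ordinal.{0} → Set DensityLogic.Cantor) (hA : DensityLogic.IsDenseSequence A)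
    (X : Set M) (hX : X.Countable) :
    ∃ N : L.Substructure M, X ⊆ (N : Set M) ∧ (N : Set M).Countable ∧
      DensityLogic.ElementaryD1 A N ∧ DensityLogic.ElementaryD0 A N := by
  obtain ⟨Z, ⟨⟨N, hN⟩, hreal⟩, hZc, hXZ, δ, hδ, hZ⟩ :=
    DensityLogic.exists_countable_of_eventually hA.stationary hX
      ((DensityLogic.eventually_exists_substructure (L := L) (M := M) DensityLogic.Countables).and
        (DensityLogic.eventually_forall_countable fun n : ℕ =>
          DensityLogic.eventually_forall_countable fun φ : DensityLogic.Fml L n =>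
            DensityLogic.eventually_realize (M := M) hA φ))
  have htrace : DensityLogic.TreeModel.IsTrace (Subtype.val : N → M) Z := by
    intro a
    rw [← Set.mem_preimage, ← hN]
    simp
  have h₁ : DensityLogic.ElementaryD1 A N := fun n φ c => hreal n φ δ hδ hZ N htrace c
  refine ⟨N, ?_, ?_, h₁, fun n φ _ c => h₁ n φ c⟩
  · rw [hN]
    exact Set.image_subset_iff.1 hXZ
  · rw [hN]
    exact hZc.preimage Sum.inl_injective
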